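/- Let $M$ be a (nonempty) first-order structure and $G(M)$ a group definable in $M$ (with parameters), regarded as a discrete group. Let $S_G(M)$ be the compact space of complete types over $M$ containing the formula that defines $G$, with the action $g\cdot \mathrm{tp}(a/M)=\mathrm{tp}(ga/M)$ of $G(M)$. Let $X$ be a compact Hausdorff space on which $G(M)$ acts by homeomorphisms, and suppose that this flow factors through $S_G(M)$: there is a continuous, surjective, $G(M)$-equivariant map $\pi\colon S_G(M)\to X$. Terminology. A CL-formula over $M$ on a definable set $D$ is a continuous function $\phi\colon S_D(M)\to\mathbb R$; for $a\in D(N)$, with $N$ an elementary extension of $M$, put $\phi(a)=\phi(\mathrm{tp}(a/M))$. For a CL-formula $F$ on $G$, $F(yx)$ is the CL-formula on $G\times G$, in the variables $x,y$, with value $F(ba)$ at $x=a$, $y=b$. A CL-formula $\phi(x,y)$ over $M$ is stable in $N$ if for no $\varepsilon>0$ are there $a_i,b_i$ ($i<\omega$) in $N$ with $|\phi(a_i,b_j)-\phi(a_j,b_i)|\ge\varepsilon$ for all $i<j$; it is stable for $T=\mathrm{Th}(M)$ if it is stable in every elementary extension of $M$ (equivalently, in a monster model). The flow is weakly almost periodic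 (wap) if for every continuous $f\colon X\to\mathbb R$, every function in the closure of $\{x\mapsto f(gx): g\in G(M)\}$ in $\mathbb R^X$ (pointwise convergence topology) is continuous. The action is definable if for every $x\in X$ and all disjoint closed $C_1,C_2\subseteq X$ there is a set $Z\subseteq G(M)$, definable in $M$ with parameters, such that $gx\in C_1$ implies $g\in Z$ and $gx\in C_2$ implies $g\notin Z$. The structure $M$ is $\omega_1$-saturated if, for every countable $A\subseteq M$, every set of formulas over $A$ in finitely many variables that is finitely satisfiable in $M$ is realized in $M$. Consider the conditions: (i) the flow $(X,G(M))$ is wap; (ii) for every continuous $f\colon X\to\mathbb R$, with $F=f\circ\pi$, the CL-formula $F(yx)$ is stable in $M$; (iii) the action of $G(M)$ on $X$ is definable. Then: (a) (i) and (ii) are equivalent, and they imply (iii); (b) if $M$ is $\omega_1$-saturated, then (i), (ii), (iii) are equivalent, and moreover, when they hold, each formula $F(yx)$ in (ii) is stable for $T$. -/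

import Mathlib

open FirstOrder

universe u v w w' z

namespace DefFlow

open FirstOrder.Language Set Topology

section Types

variable (L : FirstOrder.Language.{u, v}) {M : Type w} [L.Structure M] {α β : Type}

/-- A subset of `M^α` is definable in `M` if it is defined by a first-order formula with
parameters from `M`. -/
def IsDef (X : Set (α → M)) : Prop := (univ : Set M).Definable L X

/-- The same, with formulas over the language `L[[M]]` that has a constant for each element. -/
theorem isDef_iff (X : Set (α → M)) :
    IsDef L X ↔ ∃ φ : L[[M]].Formula α, {a : α → M | φ.Realize a} = X := by
  constructor
  · rintro ⟨φ, rfl⟩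
    have : (LHom.constantsOnMap (fun a : (univ : Set M) => (a : M))).IsExpansionOn M :=
      constantsOnMap_isExpansionOn rfl
    have : (L.lhomWithConstantsMap (fun a : (univ : Set M) => (a : M))).IsExpansionOn M :=
      LHom.sumMap_isExpansionOn _ _ M
    exact ⟨(L.lhomWithConstantsMap (fun a : (univ : Set M) => (a : M))).onFormula φ,
      ext fun a => LHom.realize_onFormula _ φ⟩
  · rintro ⟨φ, rfl⟩
    have : (LHom.constantsOnMap (fun a : M => (⟨a, mem_univ a⟩ : (univ : Set M)))).IsExpansionOn
        M := constantsOnMap_isExpansionOn rfl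
    have : (L.lhomWithConstantsMap
        (fun a : M => (⟨a, mem_univ a⟩ : (univ : Set M)))).IsExpansionOn M :=
      LHom.sumMap_isExpansionOn _ _ M
    exact ⟨(L.lhomWithConstantsMap (fun a : M => (⟨a, mem_univ a⟩ : (univ : Set M)))).onFormula φ,
      ext fun a => (LHom.realize_onFormula _ φ).symm⟩

/-- A map between subsets of powers of `M` is definable in `M` if its graph is. -/
def IsDefMap {X : Set (α → M)} {Y : Set (β → M)} (f : X → Y) : Prop :=
  IsDef L {v : α ⊕ β → M | ∃ x : X, v ∘ Sum.inl = x ∧ v ∘ Sum.inr = f x}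

/-- The product of `X ⊆ M^α` and `Y ⊆ M^β`, as a subset of `M^(α ⊕ β)`. -/
def prodSet (X : Set (α → M)) (Y : Set (β → M)) : Set (α ⊕ β → M) :=
  {v | v ∘ Sum.inl ∈ X ∧ v ∘ Sum.inr ∈ Y}

/-- The first coordinate of a point of the product. -/
def prodFst {X : Set (α → M)} {Y : Set (β → M)} (v : prodSet X Y) : X := ⟨_, v.2.1⟩

/-- The second coordinate of a point of the product. -/
def prodSnd {X : Set (α → M)} {Y : Set (β → M)} (v : prodSet X Y) : Y := ⟨_, v.2.2⟩

/-- For a definable set `X ⊆ M^α`, the space `S_X(M)` of complete types over `M` (in the variables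
`α`) which contain the formula defining `X`. It has the usual topology: a basis of open sets is
given by the sets of all types that contain a given formula over `M`. -/
def TypeSpace (X : Set (α → M)) : Type (max u v w) :=
  {p : (L.elementaryDiagram M).CompleteType α //
    ∃ φ : L[[M]].Formula α, {a : α → M | φ.Realize a} = X ∧ Formula.equivSentence φ ∈ p}

instance (X : Set (α → M)) : TopologicalSpace (TypeSpace L X) :=
  inferInstanceAs (TopologicalSpace (Subtype _))

section Points

variable (N : Type w') [L[[M]].Structure N]

/-- For `X ⊆ M^α` definable and an elementary extension `N` of `M`, the set `X(N)` which is defined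
in `N` by the formula that defines `X` in `M`.
Here and below an elementary extension of `M` is a model of the elementary diagram of `M`. -/
def points (X : Set (α → M)) : Set (α → N) :=
  {a | ∃ φ : L[[M]].Formula α, {b : α → M | φ.Realize b} = X ∧ φ.Realize a}

variable [N ⊨ L.elementaryDiagram M] [Nonempty N]

/-- The type `tp(a/M)` of a point `a ∈ X(N)`. -/
def tp {X : Set (α → M)} (a : points L N X) : TypeSpace L X :=
  ⟨(L.elementaryDiagram M).typeOf (a : α → N), by
    obtain ⟨φ, h, h'⟩ := a.2
    exact ⟨φ, h, Theory.CompleteType.formula_mem_typeOf.2 h'⟩⟩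

/-- The point `(a, b)` of `(X × Y)(N)`. -/
def pairPt {X : Set (α → M)} {Y : Set (β → M)} (a : points L N X) (b : points L N Y) :
    points L N (prodSet X Y) :=
  ⟨Sum.elim a b, by
    obtain ⟨φ, rfl, h⟩ := a.2
    obtain ⟨ψ, rfl, h'⟩ := b.2
    refine ⟨φ.relabel Sum.inl ⊓ ψ.relabel Sum.inr, ?_, ?_⟩
    · ext v
      simp [prodSet, Formula.realize_inf, Formula.realize_relabel]
    · simpa [Formula.realize_inf, Formula.realize_relabel] using And.intro h h'⟩

end Points

section Lemmas

variable {L}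

theorem exists_eq_typeOf (p : (L.elementaryDiagram M).CompleteType α) :
    ∃ (N : Type (max u v w)) (_ : L[[M]].Structure N) (_ : N ⊨ L.elementaryDiagram M)
      (_ : Nonempty N) (a : α → N), (L.elementaryDiagram M).typeOf a = p := by
  obtain ⟨N, a, ha⟩ := Theory.exists_modelType_is_realized_in _ p
  exact ⟨N, inferInstance, inferInstance, inferInstance, a, ha⟩

theorem realize_mono [Finite α] (N : Type w') [L[[M]].Structure N] [N ⊨ L.elementaryDiagram M]
    {φ ψ : L[[M]].Formula α} (h : ∀ a : α → M, φ.Realize a → ψ.Realize a)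
    (a : α → N) (ha : φ.Realize a) : ψ.Realize a := by
  let σ : L[[M]].Sentence := Formula.iAlls α ((φ.imp ψ).relabel (Sum.inr : α → Empty ⊕ α))
  have hσ : M ⊨ σ := by
    simp only [σ, Sentence.Realize, Formula.realize_iAlls, Formula.realize_relabel,
      Formula.realize_imp]
    exact fun i hi => h _ hi
  have hN : N ⊨ σ := Theory.realize_sentence_of_mem (L.elementaryDiagram M) hσ
  simp only [σ, Sentence.Realize, Formula.realize_iAlls, Formula.realize_relabel,
      Formula.realize_imp] at hN
  exact hN a ha

theorem mem_mono [Finite α] {p : (L.elementaryDiagram M).CompleteType α}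
    {φ ψ : L[[M]].Formula α} (h : ∀ a : α → M, φ.Realize a → ψ.Realize a)
    (hp : Formula.equivSentence φ ∈ p) : Formula.equivSentence ψ ∈ p := by
  obtain ⟨N, _, _, _, a, rfl⟩ := exists_eq_typeOf p
  rw [Theory.CompleteType.formula_mem_typeOf] at hp ⊢
  exact realize_mono N h a hp

theorem mem_inf {p : (L.elementaryDiagram M).CompleteType α} {φ ψ : L[[M]].Formula α}
    (hφ : Formula.equivSentence φ ∈ p) (hψ : Formula.equivSentence ψ ∈ p) :
    Formula.equivSentence (φ ⊓ ψ) ∈ p := by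
  obtain ⟨N, _, _, _, a, rfl⟩ := exists_eq_typeOf p
  rw [Theory.CompleteType.formula_mem_typeOf] at *
  exact Formula.realize_inf.2 ⟨hφ, hψ⟩

theorem exists_realize [Finite α] {p : (L.elementaryDiagram M).CompleteType α}
    {φ : L[[M]].Formula α} (hφ : Formula.equivSentence φ ∈ p) : ∃ a : α → M, φ.Realize a := by
  by_contra! h
  have := mem_mono (ψ := ⊥) (fun a ha => (h a ha).elim) hφ
  obtain ⟨N, _, _, _, a, rfl⟩ := exists_eq_typeOf p
  rw [Theory.CompleteType.formula_mem_typeOf] at this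
  exact this

theorem exists_preimage [Finite α] [Finite β] {X : Set (α → M)} {Y : Set (β → M)} {f : X → Y}
    (hf : IsDefMap L f) (σ : L[[M]].Formula β) :
    ∃ ψ : L[[M]].Formula α, ∀ a : α → M,
      ψ.Realize a ↔ ∃ h : a ∈ X, σ.Realize (f ⟨a, h⟩ : β → M) := by
  have h1 : IsDef L {v : α ⊕ β → M | σ.Realize (v ∘ Sum.inr)} :=
    (isDef_iff L _).2 ⟨σ.relabel Sum.inr, by ext v; simp [Formula.realize_relabel]⟩
  obtain ⟨ψ, hψ⟩ := (isDef_iff L _).1 (Set.Definable.exists_of_finite (Set.Definable.inter hf h1))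
  refine ⟨ψ, fun a => ?_⟩
  rw [Set.ext_iff] at hψ
  refine (hψ a).trans ⟨?_, ?_⟩
  · rintro ⟨b, ⟨x, hx, hb⟩, hσ⟩
    obtain rfl : a = x := by simpa using hx
    obtain rfl : b = f x := by simpa using hb
    exact ⟨x.2, by simpa using hσ⟩
  · rintro ⟨h, hσ⟩
    exact ⟨f ⟨a, h⟩, ⟨⟨a, h⟩, by simp, by simp⟩, by simpa using hσ⟩

variable [Nonempty M]

/-- A definable map `f : X → Y` induces `f : S_X(M) → S_Y(M)`, `tp(a/M) ↦ tp(f(a)/M)`.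
A formula `σ` belongs to the image of `p` if and only if `p` contains the formula `σ(f(x))`, that
is the formula over `M` that defines the set of all `x ∈ X` for which `σ(f(x))` holds. -/
def push [Finite α] [Finite β] {X : Set (α → M)} {Y : Set (β → M)} (f : X → Y)
    (hf : IsDefMap L f) (hY : IsDef L Y) (p : TypeSpace L X) : TypeSpace L Y :=
  ⟨{ toTheory := {τ | ∃ ψ : L[[M]].Formula α, Formula.equivSentence ψ ∈ p.1 ∧
        ∀ a : α → M, ψ.Realize a ↔
          ∃ h : a ∈ X, (Formula.equivSentence.symm τ).Realize (f ⟨a, h⟩ : β → M)}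
     subset' := by
      rintro _ ⟨τ, hτ, rfl⟩
      obtain ⟨φ, rfl, hφ⟩ := p.2
      refine ⟨φ, hφ, fun a => ⟨fun h => ⟨h, ?_⟩, fun h => h.1⟩⟩
      rw [Formula.realize_equivSentence_symm]
      let _ := constantsOn.structure (f ⟨a, h⟩ : β → M)
      exact (LHom.realize_onSentence M _ τ).2 hτ
     isMaximal' := by
      obtain ⟨φ, hX, hφ⟩ := p.2
      refine ⟨?_, fun τ => ?_⟩
      · rw [Theory.isSatisfiable_iff_isFinitelySatisfiable]
        intro s hs
        have key : ∃ ψ : L[[M]].Formula α, Formula.equivSentence ψ ∈ p.1 ∧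
            ∀ τ ∈ s, ∀ a : α → M, ψ.Realize a →
              ∃ h : a ∈ X, (Formula.equivSentence.symm τ).Realize (f ⟨a, h⟩ : β → M) := by
          classical
          induction s using Finset.induction_on with
          | empty => exact ⟨φ, hφ, by simp⟩
          | insert τ s _ ih =>
            obtain ⟨ψ, hψ, h⟩ := ih (fun x hx => hs (by simp at hx ⊢; exact Or.inr hx))
            obtain ⟨χ, hχ, h'⟩ := hs (by simp : τ ∈ ((insert τ s : Finset _) : Set _))
            refine ⟨χ ⊓ ψ, mem_inf hχ hψ, fun ρ hρ a ha => ?_⟩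
            rw [Formula.realize_inf] at ha
            rcases Finset.mem_insert.1 hρ with rfl | hρ
            · exact (h' a).1 ha.1
            · exact h ρ hρ a ha.2
        obtain ⟨ψ, hψ, h⟩ := key
        obtain ⟨a, ha⟩ := exists_realize (mem_inf hφ hψ)
        rw [Formula.realize_inf] at ha
        have haX : a ∈ X := hX ▸ ha.1
        let _ := constantsOn.structure (f ⟨a, haX⟩ : β → M)
        have : M ⊨ (s : L[[M]][[β]].Theory) := by
          refine Theory.model_iff _ |>.2 fun τ hτ => ?_
          obtain ⟨_, h⟩ := h τ hτ a ha.2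
          exact (Formula.realize_equivSentence_symm M τ _).1 h
        exact Theory.Model.isSatisfiable M
      · obtain ⟨ψ, hψ⟩ := exists_preimage hf (Formula.equivSentence.symm τ)
        rcases p.1.mem_or_not_mem (Formula.equivSentence ψ) with h | h
        · exact Or.inl ⟨ψ, h, hψ⟩
        · refine Or.inr ⟨φ ⊓ ψ.not, mem_inf hφ h, fun a => ?_⟩
          rw [Formula.realize_inf, Formula.realize_not, hψ]
          have e : (Formula.equivSentence.symm τ.not : L[[M]].Formula β) =
            (Formula.equivSentence.symm τ).not := rfl
          have hX' : φ.Realize a ↔ a ∈ X := by rw [← hX]; rfl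
          simp only [e, Formula.realize_not, hX']
          grind }, by
    obtain ⟨σ, hσ⟩ := (isDef_iff L Y).1 hY
    obtain ⟨φ, hX, hφ⟩ := p.2
    refine ⟨σ, hσ, φ, hφ, fun a => ?_⟩
    have hX' : φ.Realize a ↔ a ∈ X := by rw [← hX]; rfl
    rw [Equiv.symm_apply_apply, hX']
    exact ⟨fun h => ⟨h, hσ.ge (f ⟨a, h⟩).2⟩, fun h => h.1⟩⟩

theorem mem_push [Finite α] [Finite β] {X : Set (α → M)} {Y : Set (β → M)} {f : X → Y}
    (hf : IsDefMap L f) (hY : IsDef L Y) (p : TypeSpace L X) {ψ : L[[M]].Formula α}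
    {τ : L[[M]][[β]].Sentence} (h : ∀ a : α → M, ψ.Realize a ↔
      ∃ h : a ∈ X, (Formula.equivSentence.symm τ).Realize (f ⟨a, h⟩ : β → M)) :
    τ ∈ (push f hf hY p).1 ↔ Formula.equivSentence ψ ∈ p.1 :=
  ⟨fun ⟨_, hχ, h'⟩ => mem_mono (fun a ha => (h a).2 ((h' a).1 ha)) hχ, fun hψ => ⟨ψ, hψ, h⟩⟩

theorem continuous_push [Finite α] [Finite β] {X : Set (α → M)} {Y : Set (β → M)} {f : X → Y}
    (hf : IsDefMap L f) (hY : IsDef L Y) : Continuous (push f hf hY) := by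
  refine Continuous.subtype_mk (f := fun p => (push f hf hY p).1) ?_ _
  refine continuous_generateFrom_iff.2 ?_
  rintro _ ⟨τ, rfl⟩
  obtain ⟨ψ, hψ⟩ := exists_preimage hf (Formula.equivSentence.symm τ)
  have : (fun p => (push f hf hY p).1) ⁻¹' (Theory.typesWith _ τ) =
      Subtype.val ⁻¹' (Theory.typesWith (L.elementaryDiagram M) (Formula.equivSentence ψ)) :=
    ext fun p => mem_push hf hY p hψ
  rw [this]
  exact (CompleteType.isOpen_typesWith _).preimage continuous_subtype_val

end Lemmas

section CLFormulas

/-- A continuous logic (CL) formula on the definable set `X` over `M`. -/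
abbrev CLFormula (X : Set (α → M)) : Type (max u v w) := C(TypeSpace L X, ℝ)

variable {L} {X : Set (α → M)} {Y : Set (β → M)}

/-- The value `φ(a) = φ(tp(a/M))` of a CL-formula at a point `a ∈ X(N)`, for an elementary
extension `N` of `M`. -/
def CLFormula.eval (φ : CLFormula L X) (N : Type w') [L[[M]].Structure N]
    [N ⊨ L.elementaryDiagram M] [Nonempty N] (a : points L N X) : ℝ :=
  φ (tp L N a)

/-- A CL-formula `φ(x, y)` over `M` is stable in the elementary extension `N` of `M` if for no
`ε > 0` there are `a_i, b_i` in `N` with `|φ(a_i, b_j) - φ(a_j, b_i)| ≥ ε` for all `i < j`. -/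
def StableIn (φ : CLFormula L (prodSet X Y)) (N : Type w') [L[[M]].Structure N]
    [N ⊨ L.elementaryDiagram M] [Nonempty N] : Prop :=
  ∀ ε : ℝ, 0 < ε → ¬ ∃ (a : ℕ → points L N X) (b : ℕ → points L N Y), ∀ i j : ℕ, i < j →
    ε ≤ |CLFormula.eval φ N (pairPt L N (a i) (b j)) - CLFormula.eval φ N (pairPt L N (a j) (b i))|

/-- A CL-formula over `M` is stable for the theory `T = Th(M)` if it is stable in every elementary
extension of `M`; equivalently, in a monster model that extends `M`. (By Löwenheim–Skolem the
elementary extensions in the universe below suffice.) -/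
def Stable (φ : CLFormula L (prodSet X Y)) : Prop :=
  ∀ (N : Type (max u v w)) [L[[M]].Structure N] [N ⊨ L.elementaryDiagram M] [Nonempty N],
    StableIn φ N

end CLFormulas

end Types

/-- `M` is `ω₁`-saturated: if `A ⊆ M` is countable, then every set of formulas over `A` in finitely
many variables that is finitely satisfiable in `M` is realized in `M`. -/
def IsOmega1Saturated (L : FirstOrder.Language.{u, v}) (M : Type w) [L.Structure M] : Prop :=
  ∀ A : Set M, A.Countable → ∀ (m : ℕ) (p : Set (L[[A]].Formula (Fin m))),
    (∀ s : Finset (L[[A]].Formula (Fin m)), ↑s ⊆ p → ∃ a : Fin m → M, ∀ φ ∈ s, φ.Realize a) →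
    ∃ a : Fin m → M, ∀ φ ∈ p, φ.Realize a

/-- A group `G(M)` definable in `M` (with parameters): its universe is a definable subset of `M^n`
and its multiplication is definable. -/
structure DefinableGroup (L : FirstOrder.Language.{u, v}) (M : Type w) [L.Structure M] (n : ℕ) where
  /-- the universe of the group -/
  carrier : Set (Fin n → M)
  /-- the group structure -/
  group : Group carrier
  isDef_carrier : IsDef L carrier
  isDef_mul : IsDefMap L (fun v : prodSet carrier carrier => prodFst v * prodSnd v)

attribute [instance] DefinableGroup.group

namespace DefinableGroup

variable {L : FirstOrder.Language.{u, v}} {M : Type w} [L.Structure M] {n : ℕ}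
  (G : DefinableGroup L M n)

theorem isDef_mulLeft (g : G.carrier) : IsDefMap L (fun h : G.carrier => g * h) := by
  let F : (Fin n ⊕ Fin n → M) → ((Fin n ⊕ Fin n) ⊕ Fin n → M) := fun v =>
    Sum.elim (Sum.elim (g : Fin n → M) (v ∘ Sum.inl)) (v ∘ Sum.inr)
  have hF : (univ : Set M).DefinableMap L F := by
    rintro ((i | i) | i)
    · exact definableFun_const L _ (mem_univ _)
    · exact DefinableFun.proj L
    · exact DefinableFun.proj L
  have h := Set.Definable.preimage_map hF G.isDef_mul
  unfold IsDefMap IsDef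
  convert h using 1
  ext v
  constructor
  · rintro ⟨x, hx, hv⟩
    refine ⟨⟨Sum.elim g x, g.2, x.2⟩, ?_, ?_⟩
    · simp [F, hx]
    · exact hv
  · rintro ⟨x, hx, hv⟩
    have hx' : Sum.elim (g : Fin n → M) (v ∘ Sum.inl) = x := by simpa [F] using hx
    have h1 : prodFst x = g := Subtype.ext (by simp [prodFst, ← hx'])
    refine ⟨prodSnd x, by simp [prodSnd, ← hx'], ?_⟩
    have hv' : v ∘ Sum.inr = ((prodFst x * prodSnd x : G.carrier) : Fin n → M) := hv
    rw [hv', h1]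

theorem isDef_mulSwap :
    IsDefMap L (fun v : prodSet G.carrier G.carrier => prodSnd v * prodFst v) := by
  have h := Set.Definable.preimage_comp
    (Sum.map Sum.swap id : (Fin n ⊕ Fin n) ⊕ Fin n → (Fin n ⊕ Fin n) ⊕ Fin n) G.isDef_mul
  unfold IsDefMap IsDef
  convert h using 1
  ext v
  constructor
  · rintro ⟨x, hx, hv⟩
    refine ⟨⟨(x : Fin n ⊕ Fin n → M) ∘ Sum.swap, x.2.2, x.2.1⟩, ?_, ?_⟩
    · change _ = (x : Fin n ⊕ Fin n → M) ∘ Sum.swap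
      rw [← hx]
      ext i
      rcases i with i | i <;> rfl
    · exact hv
  · rintro ⟨x, hx, hv⟩
    refine ⟨⟨(x : Fin n ⊕ Fin n → M) ∘ Sum.swap, x.2.2, x.2.1⟩, ?_, ?_⟩
    · change _ = (x : Fin n ⊕ Fin n → M) ∘ Sum.swap
      rw [← hx]
      ext i
      rcases i with i | i <;> rfl
    · exact hv

variable [Nonempty M]

/-- The space `S_G(M)`. -/
abbrev Types : Type (max u v w) := TypeSpace L G.carrier

/-- The action of `G(M)` on `S_G(M)`: `g · tp(a/M) = tp(g a/M)`. -/
instance : SMul G.carrier G.Types :=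
  ⟨fun g => push (fun h : G.carrier => g * h) (G.isDef_mulLeft g) G.isDef_carrier⟩

/-- For a CL-formula `F(x)` on `G` over `M`, the CL-formula `F(yx)` on `G × G` over `M`, in the
variables `x, y`. -/
def mulFormula (F : CLFormula L G.carrier) : CLFormula L (prodSet G.carrier G.carrier) :=
  F.comp ⟨push (fun v : prodSet G.carrier G.carrier => prodSnd v * prodFst v)
    G.isDef_mulSwap G.isDef_carrier, continuous_push G.isDef_mulSwap G.isDef_carrier⟩

end DefinableGroup

section Flows

/-- A continuous function `f` on the `G`-flow `X` is weakly almost periodic if every function in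
the pointwise closure of the set of all `gf : x ↦ f (g x)`, `g ∈ G`, is continuous. -/
def IsWAPFun (G : Type*) {X : Type*} [Group G] [TopologicalSpace X] [MulAction G X]
    (f : C(X, ℝ)) : Prop :=
  ∀ h : X → ℝ, h ∈ closure (range fun (g : G) (x : X) => f (g • x)) → Continuous h

/-- The `G`-flow `X` is weakly almost periodic if every continuous `f : X → ℝ` is. -/
def IsWAP (G X : Type*) [Group G] [TopologicalSpace X] [MulAction G X] : Prop :=
  ∀ f : C(X, ℝ), IsWAPFun G f

/-- A map `f` from a definable set `D` to a compact space `C` is definable if any two disjoint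
closed subsets of `C` have preimages that can be separated by a set definable in `M`. -/
def IsDefinableToCompact (L : FirstOrder.Language.{u, v}) {M : Type w} [L.Structure M] {α : Type}
    {D : Set (α → M)} {C : Type*} [TopologicalSpace C] (f : D → C) : Prop :=
  ∀ C₁ C₂ : Set C, IsClosed C₁ → IsClosed C₂ → Disjoint C₁ C₂ →
    ∃ Z : Set (α → M), IsDef L Z ∧ Z ⊆ D ∧
      ∀ a : D, (f a ∈ C₁ → (a : α → M) ∈ Z) ∧ (f a ∈ C₂ → (a : α → M) ∉ Z)

/-- The action of `G(M)` on `X` is definable if all the maps `g ↦ g x` are. -/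
def IsDefinableAction {L : FirstOrder.Language.{u, v}} {M : Type w} [L.Structure M] {n : ℕ}
    (G : DefinableGroup L M n) (X : Type*) [TopologicalSpace X] [MulAction G.carrier X] : Prop :=
  ∀ x : X, IsDefinableToCompact L (fun g : G.carrier => g • x)

end Flows

end DefFlow

/-! Everything rests on Grothendieck's double limit criterion, `continuous_of_mem_closure_range`: if
`Φ j` are continuous and `h` is a pointwise limit of them that is not continuous, then a sequence of
the `Φ j` and a sequence in a given dense set can be chosen whose values above and below the
diagonal stay a fixed distance apart. The images in `X` of the types of elements of `G(M)` are
dense, and stability of `F(yx)` in `M` says exactly that no such sequences exist for the translates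
of `f` on this set. So stability in `M` gives wap; conversely, on a compact space, continuity of a
limit of translates makes the two iterated limits equal (`IsWAPFun.not_exists_seq`).

For definability of `g ↦ gx`, the point `x` is approximated by images of types of elements `a`. The
functions `q ↦ f(π(qa))` on `S_G(M)` converge along an ultrafilter, and stability, which is
symmetric in the two variables, makes the limit continuous. It extends `g ↦ f(gx)` from `G(M)` to
`S_G(M)`, so its level sets are separated by a formula.

Saturation enters twice. If the action is definable but stability fails, countably many definable
conditions are finitely satisfied by the `b_j`, and a common solution `g` would lie both inside and
outside a set separating two values of `f(gx)` (`stableIn_of_isDefinableAction`). Also, a failure of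
stability in an elementary extension is described by countably many formulas over `M`, hence can be
copied into `M` (`StableIn.stable`). -/

namespace DefFlow

open FirstOrder.Language Set Topology

/-! ### Double limits and weak almost periodicity -/

section DoubleLimit

open Filter

/-- Grothendieck's double limit criterion: if no pair of sequences, one in a family of continuous
functions and one in a dense set, witnesses that double limits fail to commute, then all the
functions in the pointwise closure of the family are continuous. -/
theorem continuous_of_mem_closure_range {Y I J : Type*} [TopologicalSpace Y] {d : I → Y}
    (hd : DenseRange d) {Φ : J → Y → ℝ} (hΦ : ∀ j, Continuous (Φ j))
    (H : ∀ ε : ℝ, 0 < ε → ¬ ∃ (a : ℕ → I) (b : ℕ → J), ∀ i j : ℕ, i < j →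
      ε ≤ |Φ (b j) (d (a i)) - Φ (b i) (d (a j))|)
    {h : Y → ℝ} (hh : h ∈ closure (range Φ)) : Continuous h := by
  have approx : ∀ (s : Set Y) (δ : ℝ), s.Finite → 0 < δ → ∃ j, ∀ y ∈ s, |Φ j y - h y| < δ := by
    intro s δ hs hδ
    have hU : {k : Y → ℝ | ∀ y ∈ s, |k y - h y| < δ} ∈ 𝓝 h := by
      have : {k : Y → ℝ | ∀ y ∈ s, |k y - h y| < δ} = ⋂ y ∈ s, {k | |k y - h y| < δ} := by
        ext; simp
      rw [this, biInter_mem hs]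
      intro y _
      have hc : Continuous fun k : Y → ℝ => |k y - h y| := by fun_prop
      exact (isOpen_lt hc continuous_const).mem_nhds (by simpa using hδ)
    obtain ⟨_, hk, j, rfl⟩ := mem_closure_iff_nhds.1 hh _ hU
    exact ⟨j, hk⟩
  have loc : ∀ (x : Y) (ε : ℝ), 0 < ε → ∃ U ∈ 𝓝 x, ∀ i, d i ∈ U → |h (d i) - h x| < ε := by
    by_contra! hcon
    obtain ⟨x, ε, hε, hx⟩ := hcon
    -- Each new function is close to `h` at `x` and at the earlier points; each new point is so near
    -- `x` that the earlier functions barely change there. Three errors below `ε / 4` leave a gap of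
    -- `ε / 4`.
    obtain ⟨f, hP, hr⟩ := exists_seq_of_forall_finset_exists
      (fun p : I × J => ε ≤ |h (d p.1) - h x| ∧ |Φ p.2 x - h x| < ε / 4)
      (fun p q => |Φ q.2 (d p.1) - h (d p.1)| < ε / 4 ∧ |Φ p.2 (d q.1) - Φ p.2 x| < ε / 4)
      (fun s _ => by
        obtain ⟨j, hj⟩ := approx (insert x ((fun p : I × J => d p.1) '' s)) (ε / 4)
          ((s.finite_toSet.image _).insert _) (by positivity)
        have hU : ⋂ p ∈ s, {y | |Φ p.2 y - Φ p.2 x| < ε / 4} ∈ 𝓝 x := by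
          rw [biInter_finset_mem]
          intro p _
          have hc : Continuous fun y => |Φ p.2 y - Φ p.2 x| :=
            ((hΦ p.2).sub continuous_const).abs
          exact (isOpen_lt hc continuous_const).mem_nhds (by simpa using hε)
        obtain ⟨i, hi, hi'⟩ := hx _ hU
        rw [mem_iInter₂] at hi
        exact ⟨(i, j), ⟨hi', hj x (mem_insert _ _)⟩, fun p hp =>
          ⟨hj _ (mem_insert_of_mem _ ⟨p, hp, rfl⟩), hi p hp⟩⟩)
    refine H (ε / 4) (by positivity) ⟨fun k => (f k).1, fun k => (f k).2, fun i j hij => ?_⟩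
    have h1 := (hP i).1
    have h2 := abs_lt.1 (hP i).2
    have h3 := abs_lt.1 (hr i j hij).1
    have h4 := abs_lt.1 (hr i j hij).2
    rcases le_abs.1 h1 with h1 | h1
    · exact le_abs.2 (Or.inl (by linarith))
    · exact le_abs.2 (Or.inr (by linarith))
  rw [continuous_iff_continuousAt]
  intro x
  rw [ContinuousAt, Metric.tendsto_nhds]
  intro ε hε
  obtain ⟨U, hU, hU'⟩ := loc x (ε / 2) (by positivity)
  -- `loc` controls `h` only on the dense set, so `h y` and `h x` are compared through a dense point
  -- near both.
  filter_upwards [eventually_mem_nhds_iff.2 hU] with y hy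
  obtain ⟨V, hV, hV'⟩ := loc y (ε / 2) (by positivity)
  obtain ⟨i, hi⟩ := hd.exists_mem_open isOpen_interior
    ⟨y, mem_interior_iff_mem_nhds.2 (inter_mem hy hV)⟩
  have hi := interior_subset hi
  have h1 := abs_lt.1 (hU' i hi.1)
  have h2 := abs_lt.1 (hV' i hi.2)
  rw [Real.dist_eq, abs_lt]
  constructor <;> linarith

theorem exists_tendsto_ultrafilter {ι Y : Type*} [TopologicalSpace Y] [CompactSpace Y]
    (𝒰 : Ultrafilter ι) (u : ι → Y) : ∃ y, Tendsto u 𝒰 (𝓝 y) := by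
  obtain ⟨y, -, hy⟩ := isCompact_univ.ultrafilter_le_nhds (𝒰.map u) (by simp)
  exact ⟨y, hy⟩

/-- The values of a continuous function on a compact space along an ultrafilter converge. -/
theorem exists_tendsto_comp_ultrafilter {ι Y : Type*} [TopologicalSpace Y] [CompactSpace Y]
    (f : C(Y, ℝ)) (𝒰 : Ultrafilter ι) (u : ι → Y) : ∃ r, Tendsto (fun i => f (u i)) 𝒰 (𝓝 r) :=
  let ⟨y, hy⟩ := exists_tendsto_ultrafilter 𝒰 u
  ⟨f y, (f.continuous.tendsto y).comp hy⟩

/-- Let `h` be the limit of the translates by `g i` and `y` the limit of the `x i` along one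
ultrafilter. Letting `j`, then `i`, tend to the limit turns the inequality into `ε ≤ |h y - h y|`:
continuity of `h` gives the first term, its definition the second. -/
theorem IsWAPFun.not_exists_seq {G X : Type*} [Group G] [TopologicalSpace X] [CompactSpace X]
    [MulAction G X] [ContinuousConstSMul G X] {f : C(X, ℝ)} (hf : IsWAPFun G f) {ε : ℝ}
    (hε : 0 < ε) : ¬ ∃ (x : ℕ → X) (g : ℕ → G), ∀ i j : ℕ, i < j →
      ε ≤ |f (g j • x i) - f (g i • x j)| := by
  rintro ⟨x, g, H⟩
  let 𝒰 : Ultrafilter ℕ := hyperfilter ℕ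
  have ev : ∀ i : ℕ, ∀ᶠ j in (𝒰 : Filter ℕ), i < j := fun i =>
    (Nat.hyperfilter_le_atTop (eventually_gt_atTop i))
  choose h hh using fun y => exists_tendsto_comp_ultrafilter f 𝒰 (fun i => g i • y)
  have hc : Continuous h := hf h (mem_closure_of_tendsto (b := (𝒰 : Filter ℕ))
    (f := fun i y => f (g i • y)) (tendsto_pi_nhds.2 hh) (Eventually.of_forall fun i => ⟨g i, rfl⟩))
  obtain ⟨y, hy⟩ := exists_tendsto_ultrafilter 𝒰 x
  have h1 : ∀ i, ε ≤ |h (x i) - f (g i • y)| := fun i => by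
    have hg : Continuous fun z => f (g i • z) := by fun_prop
    refine ge_of_tendsto (((hh (x i)).sub ((hg.tendsto y).comp hy)).abs) ?_
    filter_upwards [ev i] with j hj using H i j hj
  have h2 := ge_of_tendsto ((((hc.tendsto y).comp hy).sub (hh y)).abs) (Eventually.of_forall h1)
  simp at h2
  linarith

end DoubleLimit

/-! ### Topology of type spaces and realized types -/

section TypeSpaces

variable {L : FirstOrder.Language.{u, v}} {M : Type w} [L.Structure M] {α β : Type}

theorem mem_sup_iff {p : (L.elementaryDiagram M).CompleteType α} {φ ψ : L[[M]].Formula α} :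
    Formula.equivSentence (φ ⊔ ψ) ∈ p ↔
      Formula.equivSentence φ ∈ p ∨ Formula.equivSentence ψ ∈ p := by
  obtain ⟨N, _, _, _, a, rfl⟩ := exists_eq_typeOf p
  simp only [Theory.CompleteType.formula_mem_typeOf]
  exact Formula.realize_sup

theorem bot_notMem {p : (L.elementaryDiagram M).CompleteType α} :
    Formula.equivSentence (⊥ : L[[M]].Formula α) ∉ p := by
  obtain ⟨N, _, _, _, a, rfl⟩ := exists_eq_typeOf p
  simp only [Theory.CompleteType.formula_mem_typeOf]
  exact id

/-- All formulas defining `X` are equivalent over the elementary diagram, so a single one cuts out a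
closed set of types. -/
theorem compactSpace_typeSpace [Finite α] {X : Set (α → M)} (hX : IsDef L X) :
    CompactSpace (TypeSpace L X) := by
  obtain ⟨σ, hσ⟩ := (isDef_iff L X).1 hX
  have : {p : (L.elementaryDiagram M).CompleteType α | ∃ φ : L[[M]].Formula α,
      {a : α → M | φ.Realize a} = X ∧ Formula.equivSentence φ ∈ p} =
      Theory.typesWith _ (Formula.equivSentence σ) := by
    ext p
    refine ⟨?_, fun h => ⟨σ, hσ, h⟩⟩
    rintro ⟨φ, hφ, h⟩
    exact mem_mono (fun a ha => (hσ.trans hφ.symm).ge ha) h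
  refine isCompact_iff_compactSpace.1 (?_ : IsCompact {p | ∃ φ : L[[M]].Formula α,
      {a : α → M | φ.Realize a} = X ∧ Formula.equivSentence φ ∈ p})
  rw [this]
  exact (CompleteType.isClosed_typesWith _).isCompact

/-- Formulas give a neighbourhood basis in the space of types. -/
theorem TypeSpace.exists_formula_of_mem_nhds {X : Set (α → M)} {p : TypeSpace L X}
    {U : Set (TypeSpace L X)} (hU : U ∈ 𝓝 p) : ∃ ψ : L[[M]].Formula α,
      Formula.equivSentence ψ ∈ p.1 ∧ ∀ q : TypeSpace L X, Formula.equivSentence ψ ∈ q.1 → q ∈ U := by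
  obtain ⟨V, hV, hVU⟩ := mem_nhds_subtype _ p U |>.1 hU
  obtain ⟨_, ⟨τ, rfl⟩, hp, hτ⟩ :=
    CompleteType.isTopologicalBasis_range_typesWith.mem_nhds_iff.1 hV
  refine ⟨Formula.equivSentence.symm τ, ?_, fun q hq => hVU (hτ ?_)⟩
  · rw [Equiv.apply_symm_apply]; exact hp
  · rw [Equiv.apply_symm_apply] at hq; exact hq

theorem TypeSpace.isOpen_typesWith {X : Set (α → M)} (ψ : L[[M]].Formula α) :
    IsOpen {p : TypeSpace L X | Formula.equivSentence ψ ∈ p.1} :=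
  (CompleteType.isOpen_typesWith _).preimage continuous_subtype_val

/-- Disjoint closed sets of types are separated by a formula. -/
theorem TypeSpace.exists_formula_separating [Finite α] {X : Set (α → M)} (hX : IsDef L X)
    {C₁ C₂ : Set (TypeSpace L X)} (h₁ : IsClosed C₁) (h₂ : IsClosed C₂) (hd : Disjoint C₁ C₂) :
    ∃ ψ : L[[M]].Formula α, (∀ p ∈ C₁, Formula.equivSentence ψ ∈ p.1) ∧
      ∀ p ∈ C₂, Formula.equivSentence ψ ∉ p.1 := by
  have := compactSpace_typeSpace hX
  refine h₁.isCompact.induction_on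
    (p := fun s => ∃ ψ : L[[M]].Formula α, (∀ p ∈ s, Formula.equivSentence ψ ∈ p.1) ∧
      ∀ p ∈ C₂, Formula.equivSentence ψ ∉ p.1) ?_ ?_ ?_ ?_
  · exact ⟨⊥, by simp, fun p _ => bot_notMem⟩
  · rintro s t hst ⟨ψ, h, h'⟩
    exact ⟨ψ, fun p hp => h p (hst hp), h'⟩
  · rintro s t ⟨ψ, h, h'⟩ ⟨χ, k, k'⟩
    refine ⟨ψ ⊔ χ, fun p hp => mem_sup_iff.2 (hp.imp (h p) (k p)), fun p hp => ?_⟩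
    rw [mem_sup_iff]
    exact not_or.2 ⟨h' p hp, k' p hp⟩
  · intro p hp
    obtain ⟨ψ, h, h'⟩ := exists_formula_of_mem_nhds
      (h₂.isOpen_compl.mem_nhds (disjoint_left.1 hd hp))
    exact ⟨_, mem_nhdsWithin_of_mem_nhds ((isOpen_typesWith ψ).mem_nhds h), ψ, fun p hp => hp,
      fun q hq hψ => h' q hψ hq⟩

theorem points_self_subset {X : Set (α → M)} : points L M X ⊆ X := by
  rintro a ⟨φ, rfl, h⟩
  exact h

theorem subset_points_self {X : Set (α → M)} (hX : IsDef L X) : X ⊆ points L M X := by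
  obtain ⟨φ, rfl⟩ := (isDef_iff L X).1 hX
  exact fun a ha => ⟨φ, rfl, ha⟩

variable [Nonempty M]

/-- The type over `M` of a point of a definable set in `M`. -/
def realizedType {X : Set (α → M)} (hX : IsDef L X) (x : X) : TypeSpace L X :=
  tp L M ⟨x, subset_points_self hX x.2⟩

theorem mem_realizedType {X : Set (α → M)} (hX : IsDef L X) (x : X) {ψ : L[[M]].Formula α} :
    Formula.equivSentence ψ ∈ (realizedType hX x).1 ↔ ψ.Realize (x : α → M) :=
  Theory.CompleteType.formula_mem_typeOf

/-- A formula over `M` that belongs to a type is satisfied in `M` itself. -/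
theorem denseRange_realizedType [Finite α] {X : Set (α → M)} (hX : IsDef L X) :
    DenseRange (realizedType hX) := by
  intro p
  rw [mem_closure_iff_nhds]
  intro U hU
  obtain ⟨ψ, hp, hψ⟩ := TypeSpace.exists_formula_of_mem_nhds hU
  obtain ⟨φ, hφ, hφp⟩ := p.2
  obtain ⟨a, ha⟩ := exists_realize (mem_inf hφp hp)
  rw [Formula.realize_inf] at ha
  exact ⟨_, hψ _ ((mem_realizedType hX ⟨a, hφ.le ha.1⟩).2 ha.2), mem_range_self _⟩

theorem push_tp [Finite α] [Finite β] {X : Set (α → M)} {Y : Set (β → M)} {f : X → Y}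
    (hf : IsDefMap L f) (hY : IsDef L Y) (a : points L M X) :
    push f hf hY (tp L M a) = realizedType hY (f ⟨a, points_self_subset a.2⟩) := by
  refine Subtype.ext (SetLike.ext fun τ => ?_)
  obtain ⟨ψ, hψ⟩ := exists_preimage hf (Formula.equivSentence.symm τ)
  rw [mem_push hf hY _ hψ, ← Formula.equivSentence.apply_symm_apply τ, mem_realizedType hY]
  refine Theory.CompleteType.formula_mem_typeOf.trans ((hψ a).trans ?_)
  exact ⟨fun h => h.2, fun h => ⟨_, h⟩⟩

end TypeSpaces

/-! ### Stability, wap and definability of the action -/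

namespace DefinableGroup

variable {L : FirstOrder.Language.{u, v}} {M : Type w} [L.Structure M] {n : ℕ}
  (G : DefinableGroup L M n)

/-- Right translations need not descend to `X`, but through this they act continuously on `S_G(M)`.
-/
theorem isDef_mulRight (g : G.carrier) : IsDefMap L (fun h : G.carrier => h * g) := by
  let F : (Fin n ⊕ Fin n → M) → ((Fin n ⊕ Fin n) ⊕ Fin n → M) := fun v =>
    Sum.elim (Sum.elim (v ∘ Sum.inl) (g : Fin n → M)) (v ∘ Sum.inr)
  have hF : (univ : Set M).DefinableMap L F := by
    rintro ((i | i) | i)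
    · exact DefinableFun.proj L
    · exact definableFun_const L _ (mem_univ _)
    · exact DefinableFun.proj L
  have h := Set.Definable.preimage_map hF G.isDef_mul
  unfold IsDefMap IsDef
  convert h using 1
  ext v
  constructor
  · rintro ⟨x, hx, hv⟩
    refine ⟨⟨Sum.elim x g, x.2, g.2⟩, ?_, ?_⟩
    · simp [F, hx]
    · exact hv
  · rintro ⟨x, hx, hv⟩
    have hx' : Sum.elim (v ∘ Sum.inl) (g : Fin n → M) = x := by simpa [F] using hx
    have h1 : prodSnd x = g := Subtype.ext (by simp [prodSnd, ← hx'])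
    refine ⟨prodFst x, by simp [prodFst, ← hx'], ?_⟩
    have hv' : v ∘ Sum.inr = ((prodFst x * prodSnd x : G.carrier) : Fin n → M) := hv
    rw [hv', h1]

variable [Nonempty M]

/-- The type `tp(g/M)` of an element of `G(M)`. -/
def type (g : G.carrier) : G.Types := realizedType G.isDef_carrier g

theorem smul_type (g h : G.carrier) : g • G.type h = G.type (g * h) :=
  push_tp (G.isDef_mulLeft g) G.isDef_carrier _

theorem mulFormula_eval (F : CLFormula L G.carrier) (a b : points L M G.carrier) :
    (G.mulFormula F).eval M (pairPt L M a b) =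
      F (G.type ((⟨b, points_self_subset b.2⟩ : G.carrier) * ⟨a, points_self_subset a.2⟩)) :=
  congrArg F (push_tp G.isDef_mulSwap G.isDef_carrier _)

theorem stableIn_mulFormula_iff (F : CLFormula L G.carrier) :
    StableIn (G.mulFormula F) M ↔ ∀ ε : ℝ, 0 < ε → ¬ ∃ a b : ℕ → G.carrier, ∀ i j : ℕ, i < j →
      ε ≤ |F (G.type (b j * a i)) - F (G.type (b i * a j))| := by
  refine forall₂_congr fun ε _ => not_congr ⟨?_, ?_⟩
  · rintro ⟨a, b, H⟩
    refine ⟨fun i => ⟨a i, points_self_subset (a i).2⟩, fun i => ⟨b i, points_self_subset (b i).2⟩,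
      fun i j hij => ?_⟩
    simpa only [mulFormula_eval] using H i j hij
  · rintro ⟨a, b, H⟩
    refine ⟨fun i => ⟨a i, subset_points_self G.isDef_carrier (a i).2⟩,
      fun i => ⟨b i, subset_points_self G.isDef_carrier (b i).2⟩, fun i j hij => ?_⟩
    simpa only [mulFormula_eval] using H i j hij

variable {G} {X : Type z} [TopologicalSpace X] {π : C(G.Types, X)}

theorem denseRange_map_type (hπ : Function.Surjective π) : DenseRange fun g => π (G.type g) :=
  hπ.denseRange.comp (denseRange_realizedType G.isDef_carrier) π.continuous

variable [MulAction G.carrier X]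

theorem map_type_mul (hequiv : ∀ (g : G.carrier) (p : G.Types), π (g • p) = g • π p)
    (g h : G.carrier) : π (G.type (g * h)) = g • π (G.type h) := by
  rw [← smul_type, hequiv]

variable [ContinuousConstSMul G.carrier X]

theorem isWAPFun_of_stableIn (hπ : Function.Surjective π)
    (hequiv : ∀ (g : G.carrier) (p : G.Types), π (g • p) = g • π p)
    {f : C(X, ℝ)} (hf : StableIn (G.mulFormula (f.comp π)) M) : IsWAPFun G.carrier f := by
  rw [stableIn_mulFormula_iff] at hf
  intro h hh
  refine continuous_of_mem_closure_range (denseRange_map_type hπ)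
    (Φ := fun (g : G.carrier) x => f (g • x)) (fun g => by fun_prop) ?_ hh
  rintro ε hε ⟨a, b, H⟩
  refine hf ε hε ⟨a, b, fun i j hij => ?_⟩
  simpa only [ContinuousMap.comp_apply, map_type_mul hequiv] using H i j hij

variable [CompactSpace X]

theorem stableIn_of_isWAPFun (hequiv : ∀ (g : G.carrier) (p : G.Types), π (g • p) = g • π p)
    {f : C(X, ℝ)} (hf : IsWAPFun G.carrier f) : StableIn (G.mulFormula (f.comp π)) M := by
  rw [stableIn_mulFormula_iff]
  rintro ε hε ⟨a, b, H⟩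
  refine hf.not_exists_seq hε ⟨fun i => π (G.type (a i)), b, fun i j hij => ?_⟩
  simpa only [ContinuousMap.comp_apply, map_type_mul hequiv] using H i j hij

variable [T2Space X]

/-- Once `g ↦ f (g • x)` extends continuously to `S_G(M)`, for a Urysohn function `f`, compactness
supplies a separating formula. -/
theorem isDefinableAction_of_stableIn (hπ : Function.Surjective π)
    (hequiv : ∀ (g : G.carrier) (p : G.Types), π (g • p) = g • π p)
    (H : ∀ f : C(X, ℝ), StableIn (G.mulFormula (f.comp π)) M) : IsDefinableAction G X := by
  intro x C₁ C₂ h₁ h₂ hd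
  obtain ⟨f, hf₁, hf₂, -⟩ := exists_continuous_zero_one_of_isClosed h₁ h₂ hd
  have hf := H f
  rw [stableIn_mulFormula_iff] at hf
  let Φ : G.carrier → G.Types → ℝ := fun a q =>
    f (π (push (fun h : G.carrier => h * a) (G.isDef_mulRight a) G.isDef_carrier q))
  have hΦt : ∀ a b, Φ a (G.type b) = f (π (G.type (b * a))) := fun a b =>
    congrArg (fun q => f (π q)) (push_tp (G.isDef_mulRight a) G.isDef_carrier _)
  have hΦ : ∀ a, Continuous (Φ a) := fun a =>
    (f.continuous.comp π.continuous).comp (continuous_push _ _)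
  obtain ⟨𝒰, h𝒰⟩ : ∃ 𝒰 : Ultrafilter G.carrier,
      Filter.Tendsto (fun a => π (G.type a)) 𝒰 (𝓝 x) := by
    have hne : (Filter.comap (fun a => π (G.type a)) (𝓝 x)).NeBot :=
      Filter.comap_neBot fun t ht =>
        let ⟨_, hy, a, ha⟩ := mem_closure_iff_nhds.1 (denseRange_map_type hπ x) t ht
        ⟨a, by simpa only [ha] using hy⟩
    exact ⟨Ultrafilter.of _, Filter.tendsto_iff_comap.2 (Ultrafilter.of_le _)⟩
  choose h hh using fun q => exists_tendsto_comp_ultrafilter f 𝒰 (fun a =>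
    π (push (fun h : G.carrier => h * a) (G.isDef_mulRight a) G.isDef_carrier q))
  have hc : Continuous h := by
    refine continuous_of_mem_closure_range (denseRange_realizedType G.isDef_carrier) hΦ ?_
      (mem_closure_of_tendsto (tendsto_pi_nhds.2 hh) (Filter.Eventually.of_forall mem_range_self))
    rintro ε hε ⟨a, b, H⟩
    -- Here the family is indexed by the right factor of the product, so the two sequences change
    -- roles.
    refine hf ε hε ⟨b, a, fun i j hij => ?_⟩
    rw [abs_sub_comm]
    have := H i j hij
    rwa [show Φ (b j) (realizedType G.isDef_carrier (a i)) = _ from hΦt _ _,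
      show Φ (b i) (realizedType G.isDef_carrier (a j)) = _ from hΦt _ _] at this
  have ht : ∀ g, h (G.type g) = f (g • x) := fun g => by
    have hg : Continuous fun y => f (g • y) := by fun_prop
    refine tendsto_nhds_unique (hh _) (((hg.tendsto x).comp h𝒰).congr fun a => ?_)
    exact (congrArg f (map_type_mul hequiv g a)).symm.trans (hΦt a g).symm
  obtain ⟨ψ, hψ₁, hψ₂⟩ := TypeSpace.exists_formula_separating G.isDef_carrier
    (isClosed_singleton.preimage hc : IsClosed (h ⁻¹' {0}))
    (isClosed_singleton.preimage hc : IsClosed (h ⁻¹' {1}))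
    (Disjoint.preimage h (by simp))
  refine ⟨{a | ψ.Realize a} ∩ G.carrier,
    Set.Definable.inter ((isDef_iff L _).2 ⟨ψ, rfl⟩) G.isDef_carrier, inter_subset_right,
    fun g => ⟨fun hg => ⟨?_, g.2⟩, fun hg hg' => ?_⟩⟩
  · exact (mem_realizedType G.isDef_carrier g).1
      (hψ₁ (G.type g) ((ht g).trans (hf₁ hg)))
  · exact hψ₂ (G.type g) ((ht g).trans (hf₂ hg))
      ((mem_realizedType G.isDef_carrier g).2 hg'.1)

end DefinableGroup

/-! ### Transfer of stability by saturation -/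

section Saturation

variable {L : FirstOrder.Language.{u, v}} {M : Type w} [L.Structure M] {α β : Type}

/-- In an `ω₁`-saturated structure, countably many definable sets with the finite intersection
property have a common point. -/
theorem IsOmega1Saturated.exists_forall_mem (hM : IsOmega1Saturated L M) [Finite α]
    {D : ℕ → Set (α → M)} (hD : ∀ k, IsDef L (D k)) (hfin : ∀ K, ∃ a, ∀ k < K, a ∈ D k) :
    ∃ a, ∀ k, a ∈ D k := by
  obtain ⟨m, ⟨e⟩⟩ := Finite.exists_equiv_fin α
  have hD' : ∀ k, IsDef L ((fun x : Fin m → M => x ∘ e) ⁻¹' D k) := fun k =>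
    (hD k).preimage_comp e
  -- Each set needs only finitely many parameters, so countably many suffice for all of them.
  choose A _ hA using fun k => definable_iff_finitely_definable.1 (hD' k)
  have hdef : ∀ k, (⋃ k, (A k : Set M)).Definable L ((fun x : Fin m → M => x ∘ e) ⁻¹' D k) :=
    fun k => (hA k).mono (subset_iUnion (fun k => (A k : Set M)) k)
  choose φ hφ using hdef
  have mem : ∀ k (a : Fin m → M), (φ k).Realize a ↔ a ∘ e ∈ D k := fun k a =>
    (Set.ext_iff.1 (hφ k) a).symm
  obtain ⟨a, ha⟩ := hM (⋃ k, (A k : Set M)) (countable_iUnion fun k => (A k).countable_toSet) m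
    (range φ) (fun s hs => by
      classical
      choose! k hk using fun ψ (hψ : ψ ∈ s) => hs hψ
      obtain ⟨a, ha⟩ := hfin (s.sup k + 1)
      refine ⟨a ∘ e.symm, fun ψ hψ => ?_⟩
      rw [← hk ψ hψ, mem]
      simpa [Function.comp_assoc] using ha _ (Nat.lt_succ_of_le (Finset.le_sup (f := k) hψ)))
  exact ⟨a ∘ e, fun k => (mem k a).1 (ha _ (mem_range_self k))⟩

/-- In an `ω₁`-saturated structure, a coherent sequence of nonempty definable conditions on finite
sequences is satisfied by an infinite sequence. -/
theorem IsOmega1Saturated.exists_seq [Nonempty M] (hM : IsOmega1Saturated L M) [Finite α]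
    {E : ∀ K : ℕ, Set (Fin K × α → M)} (hE : ∀ K, IsDef L (E K)) (hne : ∀ K, (E K).Nonempty)
    (hmono : ∀ {K K' : ℕ} (h : K ≤ K'), ∀ x ∈ E K', x ∘ Prod.map (Fin.castLE h) id ∈ E K) :
    ∃ c : ℕ → α → M, ∀ K, (fun q : Fin K × α => c q.1 q.2) ∈ E K := by
  -- The first `k` terms of `c` extend to a solution of every `E K`; the later terms are irrelevant.
  let good : ℕ → (ℕ → α → M) → Prop := fun k c =>
    ∀ K, ∃ x ∈ E K, ∀ q : Fin K × α, (q.1 : ℕ) < k → x q = c q.1 q.2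
  have step : ∀ k c, good k c → ∃ d, good (k + 1) (Function.update c k d) := by
    intro k c hc
    let e : ∀ K, α → Fin (K + (k + 1)) × α := fun K l => (⟨k, by omega⟩, l)
    -- The possible values of term `k`. The shift by `k + 1` ensures that this term exists.
    let D : ℕ → Set (α → M) := fun K => (fun x => x ∘ e K) ''
      (E (K + (k + 1)) ∩ ⋂ q : Fin (K + (k + 1)) × α, {x | (q.1 : ℕ) < k → x q = c q.1 q.2})
    have hD : ∀ K, IsDef L (D K) := by
      intro K
      refine Set.Definable.image_comp (Set.Definable.inter (hE _)
        (definable_iInter_of_finite fun q => ?_)) _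
      by_cases hq : (q.1 : ℕ) < k
      · simp only [hq, forall_const]
        exact DefinableFun.ofPred_eq_const (DefinableFun.proj L) (mem_univ _)
      · simp only [hq, false_imp_iff]
        exact definable_univ
    obtain ⟨d, hd⟩ := hM.exists_forall_mem hD (fun K => by
      obtain ⟨x, hx, hxc⟩ := hc (K + (k + 1))
      refine ⟨x ∘ e K, fun k' hk' => ⟨_, ⟨hmono (by omega : k' + (k + 1) ≤ K + (k + 1)) x hx, ?_⟩,
        rfl⟩⟩
      exact mem_iInter.2 fun q hq => hxc _ hq)
    refine ⟨d, fun K => ?_⟩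
    obtain ⟨x, ⟨hx, hxc⟩, hxd⟩ := hd K
    refine ⟨_, hmono (by omega : K ≤ K + (k + 1)) x hx, fun q hq => ?_⟩
    rw [mem_iInter] at hxc
    rcases (Nat.lt_succ_iff_lt_or_eq.1 hq) with hq | hq
    · rw [Function.update_of_ne hq.ne]
      exact hxc (Prod.map (Fin.castLE _) id q) hq
    · rw [hq, Function.update_self, ← hxd]
      exact congrArg x (Prod.ext (Fin.ext hq) rfl)
  choose! d hd using step
  let c : ℕ → ℕ → α → M := fun k => Nat.rec (fun _ _ => Classical.arbitrary M)
    (fun k c => Function.update c k (d k c)) k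
  have hc : ∀ k, good k (c k) := by
    intro k
    induction k with
    | zero => exact fun K => (hne K).imp fun x hx => ⟨hx, fun q hq => absurd hq (Nat.not_lt_zero _)⟩
    | succ k ih => exact hd k _ ih
  have hcc : ∀ k i, i < k → c k i = c (i + 1) i := by
    intro k i hi
    induction k, hi using Nat.le_induction with
    | base => rfl
    | succ k hk ih => exact (Function.update_of_ne (by omega) _ _).trans ih
  refine ⟨fun i => c (i + 1) i, fun K => ?_⟩
  obtain ⟨x, hx, hxc⟩ := hc K K
  convert hx using 1
  ext q
  rw [hxc q q.1.2, hcc K _ q.1.2]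

/-- A CL-formula over an `ω₁`-saturated structure `M` is stable if it is stable in `M`. -/
theorem StableIn.stable [Nonempty M] (hM : IsOmega1Saturated L M) [Finite α] [Finite β]
    {X : Set (α → M)} {Y : Set (β → M)} {φ : CLFormula L (prodSet X Y)} (h : StableIn φ M) :
    Stable φ := by
  rintro N _ _ _ ε hε ⟨a, b, hab⟩
  -- By continuity, one formula in the type of `(a i, b j)` fixes `φ` up to `ε / 3`. Copying two
  -- values costs `2ε / 3` and leaves a gap of `ε / 3`.
  have key : ∀ i j, ∃ θ : L[[M]].Formula (α ⊕ β),
      θ.Realize (Sum.elim (a i : α → N) (b j)) ∧ {v : α ⊕ β → M | θ.Realize v} ⊆ prodSet X Y ∧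
      ∀ q : TypeSpace L (prodSet X Y), Formula.equivSentence θ ∈ q.1 →
        |φ q - φ.eval N (pairPt L N (a i) (b j))| < ε / 3 := by
    intro i j
    have hc : Continuous fun q => |φ q - φ.eval N (pairPt L N (a i) (b j))| := by fun_prop
    obtain ⟨ψ, hψ, hψ'⟩ := TypeSpace.exists_formula_of_mem_nhds
      ((isOpen_lt hc continuous_const).mem_nhds
        (by simpa [CLFormula.eval] using hε :
          tp L N (pairPt L N (a i) (b j)) ∈ {q | _ < ε / 3}))
    obtain ⟨χ, hχ, hχ'⟩ := (pairPt L N (a i) (b j)).2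
    refine ⟨χ ⊓ ψ, Formula.realize_inf.2 ⟨hχ', ?_⟩, ?_, fun q hq => hψ' q ?_⟩
    · exact Theory.CompleteType.formula_mem_typeOf.1 hψ
    · exact fun v hv => hχ.le (Formula.realize_inf.1 hv).1
    · exact mem_mono (fun v hv => (Formula.realize_inf.1 hv).2) hq
  choose θ hθ hθX hθφ using key
  -- Block `q` of the variables holds the pair `(a q, b q)`; `θ i j` reads the first half of block
  -- `i` and the second half of block `j`.
  let ι : ∀ {K : ℕ}, Fin K → Fin K → α ⊕ β → Fin K × (α ⊕ β) := fun i j =>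
    Sum.elim (fun l => (i, Sum.inl l)) (fun l => (j, Sum.inr l))
  let Θ : ∀ K : ℕ, L[[M]].Formula (Fin K × (α ⊕ β)) := fun K =>
    Formula.iInf fun p : Fin K × Fin K => (θ p.1 p.2).relabel (ι p.1 p.2)
  have hΘ : ∀ {K : ℕ} {N : Type max u v w} [L[[M]].Structure N] (x : Fin K × (α ⊕ β) → N),
      (Θ K).Realize x ↔ ∀ i j : Fin K, (θ i j).Realize (x ∘ ι i j) := by
    intro K N _ x
    simp [Θ, Formula.realize_iInf, Formula.realize_relabel]
  have hΘM : ∀ {K : ℕ} (x : Fin K × (α ⊕ β) → M),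
      (Θ K).Realize x ↔ ∀ i j : Fin K, (θ i j).Realize (x ∘ ι i j) := by
    intro K x
    simp [Θ, Formula.realize_iInf, Formula.realize_relabel]
  obtain ⟨c, hc⟩ := hM.exists_seq (E := fun K => {x | (Θ K).Realize x})
    (fun K => (isDef_iff L _).2 ⟨Θ K, rfl⟩)
    (fun K => by
      refine exists_realize (p := (L.elementaryDiagram M).typeOf
        (fun q : Fin K × (α ⊕ β) => Sum.elim (a q.1 : α → N) (b q.1) q.2))
        (Theory.CompleteType.formula_mem_typeOf.2 ((hΘ _).2 fun i j => ?_))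
      convert hθ i j using 1
      ext (l | l) <;> rfl)
    (fun h x hx => by
      refine (hΘM _).2 fun i j => ?_
      have e : (x ∘ Prod.map (Fin.castLE h) id) ∘ ι i j =
          x ∘ ι (Fin.castLE h i) (Fin.castLE h j) := by
        ext (l | l) <;> rfl
      rw [e]
      exact (hΘM _).1 hx (Fin.castLE h i) (Fin.castLE h j))
  have hc' : ∀ i j, (θ i j).Realize (Sum.elim (c i ∘ Sum.inl) (c j ∘ Sum.inr)) := by
    intro i j
    convert (hΘM _).1 (hc (i + j + 1)) ⟨i, by omega⟩ ⟨j, by omega⟩ using 1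
    ext (l | l) <;> rfl
  obtain ⟨χ, hχ, -⟩ := (a 0).2
  obtain ⟨ξ, hξ, -⟩ := (b 0).2
  let a' : ℕ → points L M X := fun i =>
    ⟨c i ∘ Sum.inl, subset_points_self ((isDef_iff L X).2 ⟨χ, hχ⟩) (hθX i i (hc' i i)).1⟩
  let b' : ℕ → points L M Y := fun i =>
    ⟨c i ∘ Sum.inr, subset_points_self ((isDef_iff L Y).2 ⟨ξ, hξ⟩) (hθX i i (hc' i i)).2⟩
  refine h (ε / 3) (by positivity) ⟨a', b', fun i j hij => ?_⟩
  have close : ∀ i j, |φ.eval M (pairPt L M (a' i) (b' j)) -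
      φ.eval N (pairPt L N (a i) (b j))| < ε / 3 := fun i j =>
    hθφ i j _ (Theory.CompleteType.formula_mem_typeOf.2 (hc' i j))
  have h1 := abs_lt.1 (close i j)
  have h2 := abs_lt.1 (close j i)
  have h3 := hab i j hij
  rcases le_abs.1 h3 with h3 | h3
  · exact le_abs.2 (Or.inl (by linarith))
  · exact le_abs.2 (Or.inr (by linarith))

end Saturation

/-! ### Definable actions over saturated structures -/

namespace DefinableGroup

variable {L : FirstOrder.Language.{u, v}} {M : Type w} [L.Structure M] [Nonempty M] {n : ℕ}
  {G : DefinableGroup L M n} {X : Type z} [TopologicalSpace X] [CompactSpace X]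
  [MulAction G.carrier X] [ContinuousConstSMul G.carrier X] {π : C(G.Types, X)}

-- With `x` the limit of the `π (G.type (a i))`, a counterexample to stability yields iterated
-- limits `r₀` and `s` at distance at least `ε`. Saturation gives one `g` that behaves like the `b
-- j` on every relevant `a i`, which pushes `f (g • x)` towards `r₀`, and that lies in a definable
-- set forcing it away from `r₀`.
open Filter in
theorem stableIn_of_isDefinableAction (hM : IsOmega1Saturated L M)
    (hequiv : ∀ (g : G.carrier) (p : G.Types), π (g • p) = g • π p)
    (hdef : IsDefinableAction G X) (f : C(X, ℝ)) : StableIn (G.mulFormula (f.comp π)) M := by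
  rw [stableIn_mulFormula_iff]
  rintro ε hε ⟨a, b, H⟩
  simp only [ContinuousMap.comp_apply, map_type_mul hequiv] at H
  let 𝒰 : Ultrafilter ℕ := hyperfilter ℕ
  have ev : ∀ i : ℕ, ∀ᶠ j in (𝒰 : Filter ℕ), i < j := fun i =>
    (Nat.hyperfilter_le_atTop (eventually_gt_atTop i))
  have hcont : ∀ g : G.carrier, Continuous fun y => f (g • y) := fun g => by fun_prop
  obtain ⟨x, hx⟩ := exists_tendsto_ultrafilter 𝒰 fun i => π (G.type (a i))
  choose r hr using fun i =>
    exists_tendsto_comp_ultrafilter f 𝒰 (fun j => b j • π (G.type (a i)))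
  obtain ⟨s, hs⟩ := exists_tendsto_comp_ultrafilter f 𝒰 (fun j => b j • x)
  obtain ⟨r₀, -, hr₀⟩ := (isCompact_range f.continuous).ultrafilter_le_nhds (𝒰.map r)
    (le_principal_iff.2 (mem_map.2 (univ_mem' fun i => (isCompact_range f.continuous).isClosed.mem_of_tendsto
      (hr i) (Eventually.of_forall fun j => mem_range_self _))))
  have h1 : ∀ i, ε ≤ |r i - f (b i • x)| := fun i => by
    refine ge_of_tendsto (((hr i).sub (((hcont (b i)).tendsto x).comp hx)).abs) ?_
    filter_upwards [ev i] with j hj using H i j hj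
  have h2 : ε ≤ |r₀ - s| :=
    ge_of_tendsto ((Tendsto.sub hr₀ hs).abs) (Eventually.of_forall h1)
  have hclosed : ∀ t δ : ℝ, IsClosed {y : ℝ | |y - t| ≤ δ} := fun t δ =>
    isClosed_le (by fun_prop) continuous_const
  obtain ⟨Z, hZ, hZG, hZ'⟩ := hdef x (f ⁻¹' {y | |y - s| ≤ ε / 4})
    (f ⁻¹' {y | |y - r₀| ≤ ε / 2}) ((hclosed _ _).preimage f.continuous)
    ((hclosed _ _).preimage f.continuous) (Disjoint.preimage f (disjoint_left.2 fun y hy hy' => by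
      have h3 := abs_le.1 (show |y - s| ≤ ε / 4 from hy)
      have h4 := abs_le.1 (show |y - r₀| ≤ ε / 2 from hy')
      rcases le_abs.1 h2 with h2 | h2 <;> linarith))
  have hF : Continuous fun p => |f (π p) - r₀| := by fun_prop
  -- A definable substitute for "`f (π p)` is near `r₀`": implied by distance at most `ε / 4`, and
  -- implying distance below `ε / 2`.
  obtain ⟨θ, hθ₁, hθ₂⟩ := TypeSpace.exists_formula_separating G.isDef_carrier
    (isClosed_le hF continuous_const : IsClosed {p | |f (π p) - r₀| ≤ ε / 4})
    (isClosed_le continuous_const hF : IsClosed {p | ε / 2 ≤ |f (π p) - r₀|})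
    (disjoint_left.2 fun p hp hp' => by
      have h3 : |f (π p) - r₀| ≤ ε / 4 := hp
      have h4 : ε / 2 ≤ |f (π p) - r₀| := hp'
      linarith)
  choose ψ hψ using fun i => exists_preimage (G.isDef_mulRight (a i)) θ
  have hI : ∀ᶠ i in (𝒰 : Filter ℕ), |r i - r₀| < ε / 8 :=
    (Tendsto.sub hr₀ tendsto_const_nhds).abs.eventually_lt_const (by simpa using hε)
  have hJ : ∀ᶠ j in (𝒰 : Filter ℕ), |f (b j • x) - s| < ε / 4 :=
    (Tendsto.sub hs tendsto_const_nhds).abs.eventually_lt_const (by simpa using hε)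
  -- Only indices with `r i` near `r₀` impose a condition; they form a set in the ultrafilter. Any
  -- finitely many conditions hold at `b j` for almost all `j`.
  obtain ⟨c, hc⟩ := hM.exists_forall_mem
    (D := fun i => Z ∩ {c | |r i - r₀| < ε / 8 → (ψ i).Realize c})
    (fun i => by
      refine Set.Definable.inter hZ ?_
      by_cases hi : |r i - r₀| < ε / 8
      · simp only [hi, forall_const]
        exact (isDef_iff L _).2 ⟨ψ i, rfl⟩
      · simp only [hi, false_imp_iff]
        exact definable_univ)
    (fun K => by
      have hK : ∀ i ∈ Finset.range K, ∀ᶠ j in (𝒰 : Filter ℕ), |r i - r₀| < ε / 8 →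
          |f (b j • π (G.type (a i))) - r₀| < ε / 4 := by
        intro i _
        by_cases hi : |r i - r₀| < ε / 8
        · have := (Tendsto.sub (hr i) (tendsto_const_nhds (x := r₀))).abs.eventually_lt_const
            (by linarith : |r i - r₀| < ε / 4)
          filter_upwards [this] with j hj _ using hj
        · exact Eventually.of_forall fun j h => absurd h hi
      obtain ⟨j, hj, hjJ⟩ := (((Finset.eventually_all _).2 hK).and hJ).exists
      refine ⟨b j, fun i hi => ⟨(hZ' (b j)).1 hjJ.le, fun hi' => (hψ i _).2 ⟨(b j).2, ?_⟩⟩⟩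
      refine (mem_realizedType G.isDef_carrier _).1 (hθ₁ (G.type (b j * a i)) ?_)
      change |f (π (G.type (b j * a i))) - r₀| ≤ ε / 4
      rw [map_type_mul hequiv]
      exact (hj i (Finset.mem_range.2 hi) hi').le)
  let g : G.carrier := ⟨c, hZG (hc 0).1⟩
  refine (hZ' g).2 ?_ (hc 0).1
  change |f (g • x) - r₀| ≤ ε / 2
  refine le_of_tendsto ((((hcont g).tendsto x).comp hx).sub (tendsto_const_nhds (x := r₀))).abs ?_
  filter_upwards [hI] with i hi
  obtain ⟨hcG, hgi⟩ := (hψ i c).1 ((hc i).2 hi)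
  by_contra! hlt
  refine hθ₂ (G.type (g * a i)) ?_ ((mem_realizedType G.isDef_carrier _).2 hgi)
  change ε / 2 ≤ |f (π (G.type (g * a i))) - r₀|
  rw [map_type_mul hequiv]
  exact hlt.le

end DefinableGroup

end DefFlow

theorem mainTheorem8 {L : FirstOrder.Language.{u, v}} {M : Type w} [L.Structure M] [Nonempty M]
    {n : ℕ} (G : DefFlow.DefinableGroup L M n)
    {X : Type z} [TopologicalSpace X] [CompactSpace X] [T2Space X]
    [MulAction G.carrier X] [ContinuousConstSMul G.carrier X]
    (π : C(G.Types, X)) (hπ : Function.Surjective π)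
    (hequiv : ∀ (g : G.carrier) (p : G.Types), π (g • p) = g • π p) :
    ((DefFlow.IsWAP G.carrier X ↔
        ∀ f : C(X, ℝ), DefFlow.StableIn (G.mulFormula (f.comp π)) M) ∧
      ((∀ f : C(X, ℝ), DefFlow.StableIn (G.mulFormula (f.comp π)) M) →
        DefFlow.IsDefinableAction G X)) ∧
    (DefFlow.IsOmega1Saturated L M →
      List.TFAE [DefFlow.IsWAP G.carrier X,
        ∀ f : C(X, ℝ), DefFlow.StableIn (G.mulFormula (f.comp π)) M,
        DefFlow.IsDefinableAction G X] ∧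
      ((∀ f : C(X, ℝ), DefFlow.StableIn (G.mulFormula (f.comp π)) M) →
        ∀ f : C(X, ℝ), DefFlow.Stable (G.mulFormula (f.comp π)))) := by
  have wap_iff : DefFlow.IsWAP G.carrier X ↔
      ∀ f : C(X, ℝ), DefFlow.StableIn (G.mulFormula (f.comp π)) M :=
    ⟨fun h f => DefFlow.DefinableGroup.stableIn_of_isWAPFun hequiv (h f),
      fun h f => DefFlow.DefinableGroup.isWAPFun_of_stableIn hπ hequiv (h f)⟩
  have def_of_stable := DefFlow.DefinableGroup.isDefinableAction_of_stableIn hπ hequiv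
  refine ⟨⟨wap_iff, def_of_stable⟩, fun hM => ⟨?_, fun h f => (h f).stable hM⟩⟩
  tfae_have 1 ↔ 2 := wap_iff
  tfae_have 2 → 3 := def_of_stable
  tfae_have 3 → 2 := DefFlow.DefinableGroup.stableIn_of_isDefinableAction hM hequiv
  tfae_finish
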